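/- Let $d\ge 2$ be a square-free integer, $F=\mathbb{Q}(\sqrt d)\subset\mathbb{R}$, $\mathcal{O}_d$ its ring of integers, and $\tau$ the non-trivial automorphism of $F$ over $\mathbb{Q}$. Let $m$ be a natural number and let $(J_n)_{n\in\mathbb{N}}$ be a sequence of non-degenerate $\tau$-Hermitian forms on $F^m$, i.e. matrices $J_n\in M_m(F)$ with $J_n^{\top}=\tau(J_n)$ and $\det J_n\neq 0$. For each $n$ let $$\Gamma_n=\mathrm{SU}(J_n;\mathcal{O}_d,\tau)=\{M\in \mathrm{SL}(m,\mathcal{O}_d):\ \tau(M)^{\top}J_nM=J_n\}<\mathrm{SL}(m,\mathbb{R}).$$ Let $(p_n)_{n\in\mathbb{N}}$ be a sequence of rational primes with $p_n\to\infty$, and let $\Gamma_n^{(p_n)}$ be the principal congruence subgroup of $\Gamma_n$ of level $p_n$, i.e. the kernel of the reduction map $\Gamma_n\to \mathrm{SL}(m,\mathcal{O}_d/(p_n))$. Then $$\mathrm{sys}(\Gamma_n^{(p_n)})\longrightarrow\infty\qquad(n\to\infty).$$ Here, for a subgroup $\Gamma<\mathrm{SL}(m,\mathbb{R})$, $\mathrm{sys}(\Gamma)$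 is the systole of $M_\Gamma=\Gamma\backslash \mathrm{SL}(m,\mathbb{R})/\mathrm{SO}(m)$, i.e. the infimum (in $[0,\infty]$) of the lengths of its non-contractible closed geodesics: the infimum, over all $\gamma\in\Gamma$ with $\gamma\ne 1$ and all geodesics $c:\mathbb{R}\to \mathrm{SL}(m,\mathbb{R})/\mathrm{SO}(m)$ with $\gamma\cdot c(t)=c(t+1)$ for all $t$ (constant $c$ being allowed when $\gamma$ fixes a point), of the length of $c|_{[0,1]}$. Lengths are taken with respect to the invariant Riemannian metric induced by the trace form $\langle X,Y\rangle=\mathrm{tr}(XY)$ on symmetric trace-free matrices; any other invariant metric changes the systole only by a constant factor. -/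

import Mathlib

open scoped ContDiff ENNReal
open Filter Topology

namespace SystoleGrowth

noncomputable section

/-! ### Hermitian forms, integral special unitary groups, congruence subgroups -/

/-- The real quadratic field `ℚ(√d)`, as a subfield of `ℝ` (with `√d > 0`). -/
abbrev quadField (d : ℕ) : IntermediateField ℚ ℝ :=
  IntermediateField.adjoin ℚ {Real.sqrt (d : ℝ)}

/-- `J` is sesqui-symmetric with respect to `τ`, that is `Jᵀ = τ(J)`: the matrix of a
`τ`-Hermitian form on `K ^ m`. -/
def IsTauHermitian {K : Type*} [Field K] [Algebra ℚ K] {m : ℕ} (τ : K ≃ₐ[ℚ] K)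
    (J : Matrix (Fin m) (Fin m) K) : Prop :=
  J.transpose = J.map τ

/-- The conjugate transpose `M* = τ(M)ᵀ`. -/
def tauStar {K : Type*} [Field K] [Algebra ℚ K] {m : ℕ} (τ : K ≃ₐ[ℚ] K)
    (M : Matrix (Fin m) (Fin m) K) : Matrix (Fin m) (Fin m) K :=
  (M.map τ).transpose

theorem tauStar_mul {K : Type*} [Field K] [Algebra ℚ K] {m : ℕ} (τ : K ≃ₐ[ℚ] K)
    (M N : Matrix (Fin m) (Fin m) K) : tauStar τ (M * N) = tauStar τ N * tauStar τ M := by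
  simp [tauStar, Matrix.map_mul, Matrix.transpose_mul]

theorem tauStar_one {K : Type*} [Field K] [Algebra ℚ K] {m : ℕ} (τ : K ≃ₐ[ℚ] K) :
    tauStar τ (1 : Matrix (Fin m) (Fin m) K) = 1 := by
  simp [tauStar]

/-- The inclusion `SL(m, 𝓞_K) → SL(m, K)`. -/
def integralToField (K : Type*) [Field K] (m : ℕ) :
    Matrix.SpecialLinearGroup (Fin m) (NumberField.RingOfIntegers K) →*
      Matrix.SpecialLinearGroup (Fin m) K :=
  Matrix.SpecialLinearGroup.map (algebraMap (NumberField.RingOfIntegers K) K)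

/-- `SU(J; K, τ) = {M ∈ SL(m, K) : M* J M = J}`. -/
def specialUnitary {K : Type*} [Field K] [Algebra ℚ K] {m : ℕ} (τ : K ≃ₐ[ℚ] K)
    (J : Matrix (Fin m) (Fin m) K) : Subgroup (Matrix.SpecialLinearGroup (Fin m) K) where
  carrier := {M | tauStar τ M.val * J * M.val = J}
  one_mem' := by simp [tauStar_one]
  mul_mem' := by
    intro M N hM hN
    simp only [Set.mem_ofPred_eq, Matrix.SpecialLinearGroup.coe_mul, tauStar_mul] at hM hN ⊢
    calc tauStar τ N.val * tauStar τ M.val * J * (M.val * N.val)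
        = tauStar τ N.val * (tauStar τ M.val * J * M.val) * N.val := by
          simp only [Matrix.mul_assoc]
      _ = J := by rw [hM, hN]
  inv_mem' := by
    intro M hM
    simp only [Set.mem_ofPred_eq] at hM ⊢
    have h1 : M.val * (M⁻¹).val = 1 := by
      rw [← Matrix.SpecialLinearGroup.coe_mul, mul_inv_cancel, Matrix.SpecialLinearGroup.coe_one]
    calc tauStar τ (M⁻¹).val * J * (M⁻¹).val
        = tauStar τ (M⁻¹).val * (tauStar τ M.val * J * M.val) * (M⁻¹).val := by rw [hM]
      _ = (tauStar τ (M⁻¹).val * tauStar τ M.val) * J * (M.val * (M⁻¹).val) := by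
          simp only [Matrix.mul_assoc]
      _ = J := by rw [← tauStar_mul, h1, tauStar_one, Matrix.one_mul, Matrix.mul_one]

/-- The integral special unitary group `SU(J; 𝓞_K, τ) = {M ∈ SL(m, 𝓞_K) : M* J M = J}`. -/
def integralSpecialUnitary {K : Type*} [Field K] [Algebra ℚ K] {m : ℕ} (τ : K ≃ₐ[ℚ] K)
    (J : Matrix (Fin m) (Fin m) K) :
    Subgroup (Matrix.SpecialLinearGroup (Fin m) (NumberField.RingOfIntegers K)) :=
  (specialUnitary τ J).comap (integralToField K m)

/-- The principal congruence subgroup of level `p` of a group `Γ ≤ SL(m, R)`: the elements of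
`Γ` in the kernel of reduction `SL(m, R) → SL(m, R / (p))`. -/
def principalCongruence {R : Type*} [CommRing R] {m : ℕ}
    (Γ : Subgroup (Matrix.SpecialLinearGroup (Fin m) R)) (p : ℕ) :
    Subgroup (Matrix.SpecialLinearGroup (Fin m) R) :=
  Γ ⊓ (Matrix.SpecialLinearGroup.map (n := Fin m)
    (Ideal.Quotient.mk (Ideal.span {(p : R)}))).ker

/-- The inclusion `SL(m, 𝓞) → SL(m, ℝ)` for the ring of integers `𝓞` of a subfield of `ℝ`. -/
def integralToReal (F : IntermediateField ℚ ℝ) (m : ℕ) :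
    Matrix.SpecialLinearGroup (Fin m) (NumberField.RingOfIntegers F) →*
      Matrix.SpecialLinearGroup (Fin m) ℝ :=
  (Matrix.SpecialLinearGroup.map (algebraMap F ℝ)).comp (integralToField F m)

/-! ### The symmetric space `SL(m, ℝ) / SO(m)` and the systole of its quotients -/

/-- The symmetric space `SL(m, ℝ) / SO(m)`, realized as the manifold of positive definite
symmetric real matrices of determinant one: the coset `g SO(m)` corresponds to `g gᵀ`, and
`g ∈ SL(m, ℝ)` acts by `P ↦ g P gᵀ`. -/
def symSpace (m : ℕ) : Set (Matrix (Fin m) (Fin m) ℝ) :=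
  {P | P.PosDef ∧ P.det = 1}

/-- The invariant Riemannian metric `⟨V, W⟩_P = (1/4) tr (P⁻¹ V P⁻¹ W)`. At the base point
`P = 1` the velocity of `exp (t X) exp (t X)ᵀ`, for `X` symmetric, is `V = 2 X`, so this is the
metric induced by the trace form `tr (X Y)`. -/
def riemMetric {m : ℕ} (P V W : Matrix (Fin m) (Fin m) ℝ) : ℝ :=
  (1 / 4) * (P⁻¹ * V * P⁻¹ * W).trace

/-- The velocity of a curve of matrices. -/
def velocity {m : ℕ} (c : ℝ → Matrix (Fin m) (Fin m) ℝ) (t : ℝ) : Matrix (Fin m) (Fin m) ℝ :=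
  Matrix.of fun i j => deriv (fun s => c s i j) t

/-- The Riemannian length of a curve on `[a, b]`. -/
def curveLength {m : ℕ} (c : ℝ → Matrix (Fin m) (Fin m) ℝ) (a b : ℝ) : ℝ :=
  ∫ t in a..b, Real.sqrt (riemMetric (c t) (velocity c t) (velocity c t))

/-- The energy of a curve on `[a, b]`. -/
def curveEnergy {m : ℕ} (c : ℝ → Matrix (Fin m) (Fin m) ℝ) (a b : ℝ) : ℝ :=
  (1 / 2) * ∫ t in a..b, riemMetric (c t) (velocity c t) (velocity c t)

/-- `h` is a smooth variation of the curve `c` through curves in the symmetric space, with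
support in `[a, b]` (so with fixed end points). -/
structure IsVariation {m : ℕ} (c : ℝ → Matrix (Fin m) (Fin m) ℝ) (a b : ℝ)
    (h : ℝ → ℝ → Matrix (Fin m) (Fin m) ℝ) : Prop where
  mem : ∀ s t, h s t ∈ symSpace m
  smooth : ∀ i j, ContDiff ℝ ∞ (fun z : ℝ × ℝ => h z.1 z.2 i j)
  zero : ∀ t, h 0 t = c t
  fixed : ∀ s t, t ∉ Set.Ioo a b → h s t = c t

/-- A geodesic `ℝ → SL(m, ℝ) / SO(m)` (parametrized proportionally to arc length, possibly
constant): a smooth curve that is a critical point of the energy on every compact interval. -/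
structure IsGeodesic {m : ℕ} (c : ℝ → Matrix (Fin m) (Fin m) ℝ) : Prop where
  mem : ∀ t, c t ∈ symSpace m
  smooth : ∀ i j, ContDiff ℝ ∞ (fun t => c t i j)
  critical : ∀ a b, a < b → ∀ h, IsVariation c a b h →
    HasDerivAt (fun s => curveEnergy (h s) a b) 0 0

/-- `c` is a geodesic of the symmetric space on which `γ` acts as the translation by one unit of
the parameter. For `γ ∈ Γ` it projects to a closed geodesic in `Γ \ SL(m, ℝ) / SO(m)`, one period
of which is the image of `[0, 1]`, in the free homotopy class given by `γ`. Conversely each closed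
geodesic of the quotient lifts to such a `c`. -/
structure IsAxis {m : ℕ} (γ : Matrix.SpecialLinearGroup (Fin m) ℝ)
    (c : ℝ → Matrix (Fin m) (Fin m) ℝ) : Prop where
  geodesic : IsGeodesic c
  translate : ∀ t, γ.val * c t * γ.val.transpose = c (t + 1)

/-- The systole of `Γ \ SL(m, ℝ) / SO(m)`: the infimum of the lengths of its non-contractible
closed geodesics, that is, of those which lift to a geodesic translated by some `γ ≠ 1` in `Γ`.
(A constant `c` can only occur if `γ` fixes a point, so never if `Γ` acts freely; it then counts
with length zero.) -/
def systole {m : ℕ} (Γ : Subgroup (Matrix.SpecialLinearGroup (Fin m) ℝ)) : ℝ≥0∞ :=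
  sInf {l : ℝ≥0∞ | ∃ γ ∈ Γ, γ ≠ 1 ∧ ∃ c : ℝ → Matrix (Fin m) (Fin m) ℝ,
    IsAxis γ c ∧ l = ENNReal.ofReal (curveLength c 0 1)}

end

end SystoleGrowth

namespace SystoleGrowth

open Matrix

/-! ### Linear algebra: normal nilpotents, the invariant metric, characteristic polynomials -/

section LinearAlgebra

variable {m : ℕ}

/-! Fix `L` and suppose that some `γ ≠ 1` of level `p` has an axis `c` of length at most `L`. The
claim is that `p` is bounded in terms of `m` and `L` alone (`level_le_of_isAxis`); since the bound
does not involve the form `J n`, letting `p n → ∞` finishes.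

Arithmetic. Let `z` be the difference between the characteristic polynomial of `γ` and `(X - 1) ^
m`, evaluated at an integer `x`. It is an algebraic integer divisible by `p`. The unitarity relation
makes `τ(γ)ᵀ` conjugate to `γ⁻¹`, so `τ z` is the same quantity for `γ⁻¹`. If `z ≠ 0`, the norm of
`z / p` is a nonzero integer, whence `p² ≤ |z| |τ z|` (`sq_le_of_mem_principalCongruence`).

Geometry, upper bound. Along a curve in the symmetric space the logarithm of any quadratic form `w ↦
wᵀ c w` changes by at most twice the length. As `c 1 = γ (c 0) γᵀ`, a conjugate of `γ` has rows of
norm at most `exp L`, and likewise for `γ⁻¹`; this bounds `|z|` and `|τ z|`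
(`IsAxis.abs_eval_charpoly_le`).

Geometry, nonvanishing. If `z = 0` at `x = 0, …, m`, then `γ` is unipotent. By Noether's theorem the
momentum `c' c⁻¹` of a geodesic is conserved, so `γ` commutes with it, and it follows that `γ` is
normal for the scalar product `(c 0)⁻¹`. A normal unipotent matrix is trivial
(`IsAxis.eq_one_of_isNilpotent`), contradicting `γ ≠ 1`. -/

open scoped MatrixOrder in
theorem exists_eq_mul_transpose_of_posDef {P : Matrix (Fin m) (Fin m) ℝ} (hP : P.PosDef) :
    ∃ g : Matrix (Fin m) (Fin m) ℝ, IsUnit g.det ∧ P = g * gᵀ := by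
  obtain ⟨b, hb⟩ := CStarAlgebra.nonneg_iff_eq_star_mul_self.mp hP.posSemidef.nonneg
  rw [star_eq_conjTranspose, conjTranspose_eq_transpose_of_trivial] at hb
  refine ⟨bᵀ, ?_, by rw [hb, transpose_transpose]⟩
  have h := hP.det_pos.ne'
  rw [hb, det_mul] at h
  exact isUnit_iff_ne_zero.mpr (left_ne_zero_of_mul h)

theorem eq_zero_of_transpose_eq_self_of_isNilpotent {S : Matrix (Fin m) (Fin m) ℝ}
    (hS : Sᵀ = S) (hn : IsNilpotent S) : S = 0 := by
  -- Exponents that are powers of two allow descent by halving: `S ^ 2 ^ (j + 1)` is the Gram matrix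
  -- of the symmetric matrix `S ^ 2 ^ j`.
  have key : ∀ j : ℕ, S ^ 2 ^ j = 0 → S = 0 := by
    intro j
    induction j with
    | zero => simp
    | succ j ih =>
      intro h
      apply ih
      rw [← conjTranspose_mul_self_eq_zero, conjTranspose_eq_transpose_of_trivial,
        transpose_pow, hS, ← pow_add, ← two_mul, ← pow_succ', h]
  obtain ⟨k, hk⟩ := hn
  exact key k (pow_eq_zero_of_le Nat.lt_two_pow_self.le hk)

/-- Normality makes `Nᵀ N` nilpotent; being symmetric, it vanishes, and hence so does `N`. -/
theorem eq_zero_of_commute_transpose_of_isNilpotent {N : Matrix (Fin m) (Fin m) ℝ}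
    (hN : Commute Nᵀ N) (hn : IsNilpotent N) : N = 0 := by
  rw [← conjTranspose_mul_self_eq_zero, conjTranspose_eq_transpose_of_trivial]
  refine eq_zero_of_transpose_eq_self_of_isNilpotent (by simp) ?_
  exact hN.isNilpotent_mul_left hn

/-- A unipotent matrix which is normal for the scalar product `P⁻¹` is trivial. -/
theorem eq_one_of_isNilpotent_of_commute {P γ : Matrix (Fin m) (Fin m) ℝ} (hP : P.PosDef)
    (hγ : IsNilpotent (γ - 1)) (hc : Commute γᵀ (P⁻¹ * γ * P)) : γ = 1 := by
  obtain ⟨g, hg, rfl⟩ := exists_eq_mul_transpose_of_posDef hP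
  have hg' : IsUnit gᵀ.det := by rwa [det_transpose]
  have h1 : g * g⁻¹ = 1 := mul_nonsing_inv _ hg
  have h2 : g⁻¹ * g = 1 := nonsing_inv_mul _ hg
  have h3 : gᵀ * gᵀ⁻¹ = 1 := mul_nonsing_inv _ hg'
  have h4 : gᵀ⁻¹ * gᵀ = 1 := nonsing_inv_mul _ hg'
  -- In the frame `g`, which is orthonormal for the scalar product, the adjoint is the ordinary
  -- transpose, so the hypothesis says that `N` is normal.
  set N := g⁻¹ * (γ - 1) * g with hNdef
  have hNT : Nᵀ = gᵀ * (γᵀ - 1) * gᵀ⁻¹ := by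
    rw [hNdef, transpose_mul, transpose_mul, transpose_nonsing_inv, transpose_sub, transpose_one,
      Matrix.mul_assoc]
  have hc' : Commute (γᵀ - 1) ((g * gᵀ)⁻¹ * γ * (g * gᵀ) - 1) :=
    (hc.sub_left (Commute.one_left _)).sub_right (Commute.one_right _)
  have hN2 : N = gᵀ * ((g * gᵀ)⁻¹ * γ * (g * gᵀ) - 1) * gᵀ⁻¹ := by
    rw [Matrix.mul_inv_rev, hNdef]
    calc g⁻¹ * (γ - 1) * g = g⁻¹ * γ * g - g⁻¹ * g := by noncomm_ring
      _ = (gᵀ * gᵀ⁻¹) * (g⁻¹ * γ * g) * (gᵀ * gᵀ⁻¹) - (gᵀ * gᵀ⁻¹) := by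
        rw [h3, h2, Matrix.one_mul, Matrix.mul_one]
      _ = _ := by noncomm_ring
  have hcomm : Commute Nᵀ N := by
    have e : ∀ X Y : Matrix (Fin m) (Fin m) ℝ,
        (gᵀ * X * gᵀ⁻¹) * (gᵀ * Y * gᵀ⁻¹) = gᵀ * (X * Y) * gᵀ⁻¹ := by
      intro X Y
      calc _ = gᵀ * X * (gᵀ⁻¹ * gᵀ) * Y * gᵀ⁻¹ := by noncomm_ring
        _ = _ := by rw [h4]; noncomm_ring
    rw [Commute, SemiconjBy, hNT, hN2, e, e, hc'.eq]
  have hnil : IsNilpotent N := by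
    obtain ⟨k, hk⟩ := hγ
    refine ⟨k, ?_⟩
    have : ∀ k : ℕ, N ^ k = g⁻¹ * (γ - 1) ^ k * g := by
      intro k
      induction k with
      | zero => simp [h2]
      | succ k ih =>
        rw [pow_succ, ih, hNdef, pow_succ]
        calc _ = g⁻¹ * (γ - 1) ^ k * (g * g⁻¹) * (γ - 1) * g := by noncomm_ring
          _ = _ := by rw [h1]; noncomm_ring
    rw [this, hk]; simp
  have h0 := eq_zero_of_commute_transpose_of_isNilpotent hcomm hnil
  have : γ - 1 = g * N * g⁻¹ := by
    rw [hNdef]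
    calc γ - 1 = 1 * (γ - 1) * 1 := by simp
      _ = (g * g⁻¹) * (γ - 1) * (g * g⁻¹) := by rw [h1]
      _ = _ := by noncomm_ring
  rw [h0] at this
  simpa [sub_eq_zero] using this

/-- A trace-free matrix which is orthogonal to all nilpotent matrices of rank one vanishes. -/
theorem eq_zero_of_trace_mul_vecMulVec_eq_zero {M : Matrix (Fin m) (Fin m) ℝ} (htr : M.trace = 0)
    (h : ∀ u w : Fin m → ℝ, w ⬝ᵥ u = 0 → (M * vecMulVec u w).trace = 0) : M = 0 := by
  have hvec : ∀ u w : Fin m → ℝ, w ⬝ᵥ u = 0 → w ⬝ᵥ M *ᵥ u = 0 := by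
    intro u w huw
    have := h u w huw
    rwa [mul_vecMulVec, trace_vecMulVec, dotProduct_comm] at this
  have hoff : ∀ i j, i ≠ j → M i j = 0 := by
    intro i j hij
    simpa using hvec (Pi.single j 1) (Pi.single i 1) (by simp [hij])
  have hdiag : ∀ i j, M i i = M j j := by
    intro i j
    rcases eq_or_ne i j with rfl | hij
    · rfl
    -- These two vectors are orthogonal; with the off-diagonal entries gone, their pairing is `M i i
    -- - M j j`.
    have := hvec (Pi.single i 1 + Pi.single j 1) (Pi.single i 1 - Pi.single j 1)
      (by simp [hij, hij.symm])
    simp [mulVec_add, hoff i j hij, hoff j i hij.symm] at this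
    linarith
  ext i j
  rcases eq_or_ne i j with rfl | hij
  · have h1 : M.trace = m * M i i := by
      simp [trace, fun j => hdiag j i]
    have hm : (m : ℝ) ≠ 0 := by
      have := i.pos
      positivity
    simpa [htr, hm] using h1.symm
  · simpa using hoff i j hij

/-- Cauchy–Schwarz for the invariant metric. -/
theorem abs_dotProduct_mulVec_le {P V : Matrix (Fin m) (Fin m) ℝ} (hP : P.PosDef) (hV : Vᵀ = V)
    (w : Fin m → ℝ) :
    |w ⬝ᵥ V *ᵥ w| ≤ 2 * √(riemMetric P V V) * (w ⬝ᵥ P *ᵥ w) := by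
  obtain ⟨g, hg, rfl⟩ := exists_eq_mul_transpose_of_posDef hP
  have hg' : IsUnit gᵀ.det := by rwa [det_transpose]
  have h1 : g * g⁻¹ = 1 := mul_nonsing_inv _ hg
  have h2 : g⁻¹ * g = 1 := nonsing_inv_mul _ hg
  have h3 : gᵀ * gᵀ⁻¹ = 1 := mul_nonsing_inv _ hg'
  have h4 : gᵀ⁻¹ * gᵀ = 1 := nonsing_inv_mul _ hg'
  -- In the frame `g` the metric becomes a quarter of the squared Frobenius norm; that quarter is
  -- the origin of the factor 2 in the bound.
  set S := g⁻¹ * V * gᵀ⁻¹ with hS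
  have hVS : V = g * S * gᵀ := by
    rw [hS]
    calc V = 1 * V * 1 := by simp
      _ = (g * g⁻¹) * V * (gᵀ⁻¹ * gᵀ) := by rw [h1, h4]
      _ = _ := by noncomm_ring
  have hST : Sᵀ = S := by
    rw [hS]; simp [transpose_nonsing_inv, hV, Matrix.mul_assoc]
  have hmet : riemMetric (g * gᵀ) V V = 1 / 4 * ∑ i, ∑ j, S i j ^ 2 := by
    have : ((g * gᵀ)⁻¹ * V * (g * gᵀ)⁻¹ * V).trace = (S * Sᵀ).trace := by
      rw [hST, Matrix.mul_inv_rev]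
      calc _ = (gᵀ⁻¹ * (g⁻¹ * V * gᵀ⁻¹ * g⁻¹ * V)).trace := by congr 1; noncomm_ring
        _ = _ := by rw [trace_mul_comm, hS]; congr 1; noncomm_ring
    rw [riemMetric, this]
    simp [trace, mul_apply, sq]
  set u := gᵀ *ᵥ w with hu
  have hconj : ∀ X : Matrix (Fin m) (Fin m) ℝ, w ⬝ᵥ (g * X * gᵀ) *ᵥ w = u ⬝ᵥ X *ᵥ u := by
    intro X
    rw [hu, ← mulVec_mulVec, ← mulVec_mulVec, dotProduct_mulVec, ← mulVec_transpose]
  have hP' : w ⬝ᵥ (g * gᵀ) *ᵥ w = ∑ i, u i ^ 2 := by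
    have := hconj 1
    rw [Matrix.mul_one] at this
    rw [this]; simp [dotProduct, sq]
  have hV' : w ⬝ᵥ V *ᵥ w = ∑ i, u i * ∑ j, S i j * u j := by
    rw [hVS, hconj]; rfl
  rw [hV', hP', hmet]
  have hsum0 : 0 ≤ ∑ i, u i ^ 2 := Finset.sum_nonneg fun i _ => sq_nonneg _
  have hcs : (∑ i, u i * ∑ j, S i j * u j) ^ 2
      ≤ (∑ i, u i ^ 2) ^ 2 * ∑ i, ∑ j, S i j ^ 2 := by
    calc (∑ i, u i * ∑ j, S i j * u j) ^ 2
        ≤ (∑ i, u i ^ 2) * ∑ i, (∑ j, S i j * u j) ^ 2 := Finset.sum_mul_sq_le_sq_mul_sq _ _ _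
      _ ≤ (∑ i, u i ^ 2) * ∑ i, ((∑ j, S i j ^ 2) * ∑ j, u j ^ 2) := by
        gcongr with i; exact Finset.sum_mul_sq_le_sq_mul_sq _ _ _
      _ = _ := by rw [← Finset.sum_mul]; ring
  have h2s : 2 * √(1 / 4 * ∑ i, ∑ j, S i j ^ 2) = √(∑ i, ∑ j, S i j ^ 2) := by
    rw [Real.sqrt_mul (by norm_num), show (1 / 4 : ℝ) = (1 / 2) ^ 2 by norm_num,
      Real.sqrt_sq (by norm_num)]
    ring
  rw [h2s]
  refine abs_le_of_sq_le_sq ?_ (mul_nonneg (Real.sqrt_nonneg _) hsum0)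
  have hS0 : 0 ≤ ∑ i, ∑ j, S i j ^ 2 :=
    Finset.sum_nonneg fun i _ => Finset.sum_nonneg fun j _ => sq_nonneg (S i j)
  rw [mul_pow, Real.sq_sqrt hS0]
  linarith

/-- If `γ P γᵀ ≤ r² P` as quadratic forms then `det (x - γ)` is bounded in terms of `r`. -/
theorem abs_eval_charpoly_le {P γ : Matrix (Fin m) (Fin m) ℝ} (hP : P.PosDef) {r x : ℝ}
    (hr : 0 ≤ r) (h : ∀ w, w ⬝ᵥ (γ * P * γᵀ) *ᵥ w ≤ r ^ 2 * (w ⬝ᵥ P *ᵥ w)) :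
    |γ.charpoly.eval x| ≤ m.factorial * (|x| + r) ^ m := by
  obtain ⟨g, hg, rfl⟩ := exists_eq_mul_transpose_of_posDef hP
  have hg' : IsUnit gᵀ.det := by rwa [det_transpose]
  have h1 : g * g⁻¹ = 1 := mul_nonsing_inv _ hg
  have h2 : g⁻¹ * g = 1 := nonsing_inv_mul _ hg
  have h3 : gᵀ * gᵀ⁻¹ = 1 := mul_nonsing_inv _ hg'
  have h4 : gᵀ⁻¹ * gᵀ = 1 := nonsing_inv_mul _ hg'
  set k := g⁻¹ * γ * g with hk
  have hchar : γ.charpoly = k.charpoly := by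
    rw [hk, charpoly_mul_comm, ← Matrix.mul_assoc, h1, Matrix.one_mul]
  have hrow : ∀ i, ∑ j, k i j ^ 2 ≤ r ^ 2 := by
    intro i
    -- On this vector the hypothesis compares the `i`-th diagonal entries of `k kᵀ` and `r² • 1`,
    -- that is, it bounds the `i`-th row of `k`.
    have := h (gᵀ⁻¹ *ᵥ Pi.single i 1)
    have e : ∀ X : Matrix (Fin m) (Fin m) ℝ,
        (gᵀ⁻¹ *ᵥ Pi.single i 1) ⬝ᵥ X *ᵥ (gᵀ⁻¹ *ᵥ Pi.single i 1) = (g⁻¹ * X * gᵀ⁻¹) i i := by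
      intro X
      rw [dotProduct_mulVec, vecMul_mulVec, ← dotProduct_mulVec, mulVec_mulVec, ← transpose_nonsing_inv,
        transpose_transpose]
      simp [Matrix.mul_assoc]
    rw [e, e] at this
    have e1 : g⁻¹ * (γ * (g * gᵀ) * γᵀ) * gᵀ⁻¹ = k * kᵀ := by
      rw [hk]; simp only [transpose_mul, transpose_nonsing_inv]; noncomm_ring
    have e2 : g⁻¹ * (g * gᵀ) * gᵀ⁻¹ = 1 := by
      rw [← Matrix.mul_assoc, h2, Matrix.one_mul, h3]
    rw [e1, e2] at this
    simpa [mul_apply, sq] using this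
  rw [hchar, eval_charpoly]
  have := det_le (A := scalar (Fin m) x - k) (abv := AbsoluteValue.abs) (x := |x| + r) (by
    intro i j
    have hkij : |k i j| ≤ r := by
      refine abs_le_of_sq_le_sq ?_ hr
      exact (Finset.single_le_sum (f := fun j => k i j ^ 2) (fun j _ => sq_nonneg _)
        (Finset.mem_univ j)).trans (hrow i)
    have hs : |(scalar (Fin m) x) i j| ≤ |x| := by
      rcases eq_or_ne i j with rfl | hij
      · simp
      · simp [hij]
    simp only [AbsoluteValue.abs_apply, Matrix.sub_apply]
    exact (abs_sub _ _).trans (add_le_add hs hkij))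
  simpa using this

theorem isNilpotent_sub_one_of_charpoly {R : Type*} [CommRing R] {γ : Matrix (Fin m) (Fin m) R}
    (h : γ.charpoly = (Polynomial.X - 1) ^ m) : IsNilpotent (γ - 1) := by
  refine ⟨m, ?_⟩
  have := aeval_self_charpoly γ
  rw [h] at this
  simpa using this

/-- Both polynomials have degree `m`, so agreement at `m + 1` distinct points suffices;
characteristic zero keeps the points distinct. -/
theorem charpoly_eq_of_forall_eval {R : Type*} [CommRing R] [IsDomain R] [CharZero R]
    {γ : Matrix (Fin m) (Fin m) R}
    (h : ∀ x ∈ Finset.range (m + 1), γ.charpoly.eval (x : R) = ((x : R) - 1) ^ m) :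
    γ.charpoly = (Polynomial.X - 1) ^ m := by
  classical
  refine Polynomial.eq_of_degrees_lt_of_eval_finset_eq
    ((Finset.range (m + 1)).image (fun n : ℕ => (n : R))) ?_ ?_ ?_
  · rw [Finset.card_image_of_injective _ Nat.cast_injective, charpoly_degree_eq_dim]
    simp; exact_mod_cast Nat.lt_succ_self m
  · rw [Finset.card_image_of_injective _ Nat.cast_injective, Polynomial.degree_pow,
      ← Polynomial.C_1, Polynomial.degree_X_sub_C]
    simp; exact_mod_cast Nat.lt_succ_self m
  · simpa using h

end LinearAlgebra

/-! ### Norms in the quadratic field and congruences of characteristic polynomials -/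

section Arithmetic

open NumberField

theorem exists_eq_add_mul_sqrt (d : ℕ) (y : quadField d) :
    ∃ a b : ℚ, (y : ℝ) = a + b * √(d : ℝ) := by
  have hint : IsAlgebraic ℚ √(d : ℝ) := by
    refine (IsIntegral.of_pow (n := 2) (by norm_num) ?_).isAlgebraic
    rw [Real.sq_sqrt (Nat.cast_nonneg d)]
    exact isIntegral_algebraMap (R := ℚ) (A := ℝ) (x := (d : ℚ))
  have hy : (y : ℝ) ∈ Algebra.adjoin ℚ {√(d : ℝ)} := by
    rw [← IntermediateField.adjoin_simple_toSubalgebra_of_isAlgebraic hint]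
    exact y.2
  generalize (y : ℝ) = t at hy
  induction hy using Algebra.adjoin_induction with
  | mem x hx => exact ⟨0, 1, by simpa using hx⟩
  | algebraMap r => exact ⟨r, 0, by simp⟩
  | add x y _ _ hx hy =>
    obtain ⟨a, b, rfl⟩ := hx
    obtain ⟨a', b', rfl⟩ := hy
    exact ⟨a + a', b + b', by push_cast; ring⟩
  | mul x y _ _ hx hy =>
    obtain ⟨a, b, rfl⟩ := hx
    obtain ⟨a', b', rfl⟩ := hy
    refine ⟨a * a' + b * b' * d, a * b' + a' * b, ?_⟩
    have := Real.mul_self_sqrt (Nat.cast_nonneg (α := ℝ) d)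
    push_cast
    linear_combination (b * b' : ℝ) * this

theorem exists_rat_eq_mul_apply {d : ℕ} {τ : quadField d ≃ₐ[ℚ] quadField d} (hτ : τ ≠ 1)
    (y : quadField d) : ∃ q : ℚ, algebraMap ℚ (quadField d) q = y * τ y := by
  let s : quadField d :=
    ⟨√(d : ℝ), IntermediateField.subset_adjoin ℚ _ (Set.mem_singleton _)⟩
  have hs : s * s = algebraMap ℚ (quadField d) d := by
    apply Subtype.ext
    simp [s]
  have hτs : τ s = -s := by
    have h1 : τ s * τ s = s * s := by
      rw [← map_mul, hs, AlgEquiv.commutes]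
    rcases mul_self_eq_mul_self_iff.mp h1 with h | h
    · exfalso
      apply hτ
      have : (τ : quadField d →ₐ[ℚ] quadField d) = AlgHom.id ℚ _ := by
        refine IntermediateField.algHom_ext_of_eq_adjoin ℚ rfl ?_
        rintro x rfl
        exact h
      ext x : 1
      exact DFunLike.congr_fun this x
    · exact h
  obtain ⟨a, b, hab⟩ := exists_eq_add_mul_sqrt d y
  have hy : y = algebraMap ℚ (quadField d) a + algebraMap ℚ (quadField d) b * s :=
    Subtype.ext (by simpa [s] using hab)
  refine ⟨a * a - b * b * d, ?_⟩
  rw [hy, map_add, map_mul, hτs, AlgEquiv.commutes, AlgEquiv.commutes, map_sub, map_mul, map_mul,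
    map_mul, ← hs]
  ring

/-- The product `w * τ w` is rational and integral over `ℤ`, hence a nonzero integer. -/
theorem one_le_abs_mul_apply {d : ℕ} {τ : quadField d ≃ₐ[ℚ] quadField d} (hτ : τ ≠ 1)
    {w : 𝓞 (quadField d)} (hw : w ≠ 0) :
    1 ≤ |((w : quadField d) : ℝ)| * |((τ (w : quadField d) : quadField d) : ℝ)| := by
  obtain ⟨q, hq⟩ := exists_rat_eq_mul_apply hτ (w : quadField d)
  have hint : IsIntegral ℤ (algebraMap ℚ (quadField d) q) := by
    rw [hq]
    exact w.isIntegral_coe.mul (w.isIntegral_coe.map (τ.toAlgHom.restrictScalars ℤ))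
  rw [isIntegral_algebraMap_iff (algebraMap ℚ (quadField d)).injective,
    IsIntegrallyClosed.isIntegral_iff] at hint
  obtain ⟨n, rfl⟩ := hint
  have hw' : (w : quadField d) ≠ 0 := by simpa using hw
  have hn : n ≠ 0 := by
    rintro rfl
    have : (w : quadField d) * τ w ≠ 0 := mul_ne_zero hw' (by simpa using hw')
    exact this (by rw [← hq]; simp)
  have h := congrArg (fun z : quadField d => |(z : ℝ)|) hq
  simp only [MulMemClass.coe_mul, abs_mul] at h
  rw [← h]
  have : (1 : ℝ) ≤ |(n : ℝ)| := by exact_mod_cast Int.one_le_abs hn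
  simpa using this

/-- If the characteristic polynomial of an element of the congruence subgroup of level `p` differs
at `x` from `(x - 1) ^ m`, then it or that of the inverse differs from it by at least `p`. -/
theorem sq_le_of_mem_principalCongruence {d m : ℕ} {τ : quadField d ≃ₐ[ℚ] quadField d}
    (hτ : τ ≠ 1) {J : Matrix (Fin m) (Fin m) (quadField d)} (hJ : J.det ≠ 0) {p : ℕ}
    {M : Matrix.SpecialLinearGroup (Fin m) (𝓞 (quadField d))}
    (hM : M ∈ principalCongruence (integralSpecialUnitary τ J) p) (x : ℕ)
    (hx : (integralToReal (quadField d) m M).val.charpoly.eval (x : ℝ) ≠ ((x : ℝ) - 1) ^ m) :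
    (p : ℝ) ^ 2 ≤
      |(integralToReal (quadField d) m M).val.charpoly.eval (x : ℝ) - ((x : ℝ) - 1) ^ m| *
      |(integralToReal (quadField d) m M)⁻¹.val.charpoly.eval (x : ℝ) - ((x : ℝ) - 1) ^ m| := by
  obtain ⟨hM1, hM2⟩ := hM
  set z : 𝓞 (quadField d) := M.val.charpoly.eval (x : 𝓞 (quadField d)) - ((x : 𝓞 (quadField d)) - 1) ^ m with hz
  have hMF : (integralToField (quadField d) m M).val = M.val.map (algebraMap (𝓞 (quadField d)) (quadField d)) := rfl
  have hMR : (integralToReal (quadField d) m M).val = (integralToField (quadField d) m M).val.map (algebraMap (quadField d) ℝ) := rfl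
  have hMRi : (integralToReal (quadField d) m M)⁻¹.val =
      (integralToField (quadField d) m M)⁻¹.val.map (algebraMap (quadField d) ℝ) := by
    rw [← map_inv, ← map_inv]; rfl
  have hzF : (z : (quadField d)) = (integralToField (quadField d) m M).val.charpoly.eval (x : (quadField d)) - ((x : (quadField d)) - 1) ^ m := by
    rw [hMF, charpoly_map, Polynomial.eval_natCast_map, hz]
    simp
  have hzR : ((z : (quadField d)) : ℝ) =
      (integralToReal (quadField d) m M).val.charpoly.eval (x : ℝ) - ((x : ℝ) - 1) ^ m := by
    rw [hMR, charpoly_map, Polynomial.eval_natCast_map, hzF]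
    simp
  -- The relation `M* J M = J` reads `M* = J M⁻¹ J⁻¹`, and characteristic polynomials are invariant
  -- under transposition and conjugation.
  have hτchar : ((integralToField (quadField d) m M).val.map τ).charpoly =
      (integralToField (quadField d) m M)⁻¹.val.charpoly := by
    set A := integralToField (quadField d) m M
    have hA : tauStar τ A.val * J * A.val = J := hM1
    have hJu : IsUnit J.det := isUnit_iff_ne_zero.mpr hJ
    have hAA : A.val * (A⁻¹).val = 1 := by
      rw [← Matrix.SpecialLinearGroup.coe_mul, mul_inv_cancel, Matrix.SpecialLinearGroup.coe_one]
    have h1 : tauStar τ A.val * J = J * (A⁻¹).val := by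
      calc _ = tauStar τ A.val * J * (A.val * (A⁻¹).val) := by rw [hAA, Matrix.mul_one]
        _ = (tauStar τ A.val * J * A.val) * (A⁻¹).val := by noncomm_ring
        _ = _ := by rw [hA]
    have h2 : tauStar τ A.val = J * ((A⁻¹).val * J⁻¹) := by
      rw [← Matrix.mul_assoc, ← h1, Matrix.mul_assoc, mul_nonsing_inv _ hJu, Matrix.mul_one]
    rw [← charpoly_transpose, show (A.val.map τ)ᵀ = tauStar τ A.val from rfl, h2,
      charpoly_mul_comm, Matrix.mul_assoc, nonsing_inv_mul _ hJu, Matrix.mul_one]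
  have hτz : ((τ (z : (quadField d)) : (quadField d)) : ℝ) =
      (integralToReal (quadField d) m M)⁻¹.val.charpoly.eval (x : ℝ) - ((x : ℝ) - 1) ^ m := by
    have h3 := charpoly_map (integralToField (quadField d) m M).val (τ : (quadField d) →+* (quadField d))
    have h4 := congrArg (Polynomial.eval (x : (quadField d))) h3
    rw [Polynomial.eval_natCast_map] at h4
    rw [hMRi, charpoly_map, Polynomial.eval_natCast_map, ← hτchar, hzF, map_sub]
    erw [h4]
    simp
  -- Modulo `p` the matrix is the identity, whose characteristic polynomial is `(X - 1) ^ m`.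
  have hdvd : (p : 𝓞 (quadField d)) ∣ z := by
    rw [← Ideal.mem_span_singleton, ← Ideal.Quotient.eq_zero_iff_mem]
    have h1 : M.val.map (Ideal.Quotient.mk (Ideal.span {(p : 𝓞 (quadField d))})) = 1 :=
      congrArg (fun A : Matrix.SpecialLinearGroup (Fin m) _ => A.val) (MonoidHom.mem_ker.mp hM2)
    have h2 := charpoly_map M.val (Ideal.Quotient.mk (Ideal.span {(p : 𝓞 (quadField d))}))
    rw [h1, charpoly_one, Fintype.card_fin] at h2
    have h3 := congrArg (Polynomial.eval (x : 𝓞 (quadField d) ⧸ Ideal.span {(p : 𝓞 (quadField d))})) h2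
    rw [Polynomial.eval_natCast_map] at h3
    rw [hz, map_sub, ← h3]
    simp
  obtain ⟨w, hw⟩ := hdvd
  have hw0 : w ≠ 0 := by
    rintro rfl
    apply hx
    rw [← sub_eq_zero, ← hzR, hw]
    simp
  have h1 := one_le_abs_mul_apply hτ hw0
  rw [← hzR, ← hτz, hw]
  have e1 : (((p * w : 𝓞 (quadField d)) : (quadField d)) : ℝ) = p * ((w : (quadField d)) : ℝ) := by simp
  have e2 : ((τ ((p * w : 𝓞 (quadField d)) : (quadField d)) : (quadField d)) : ℝ) = p * ((τ (w : (quadField d)) : (quadField d)) : ℝ) := by simp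
  rw [e1, e2, abs_mul, abs_mul, Nat.abs_cast]
  nlinarith [sq_nonneg (p : ℝ)]

end Arithmetic

/-! ### Curves and geodesics in the symmetric space: length estimates and Noether's theorem -/

section Curves

attribute [local instance] Matrix.linftyOpNormedAddCommGroup Matrix.linftyOpNormedSpace
  Matrix.linftyOpNormedRing Matrix.linftyOpNormedAlgebra

variable {m : ℕ}

theorem contDiff_matrix {E : Type*} [NormedAddCommGroup E] [NormedSpace ℝ E] {n : WithTop ℕ∞}
    {c : E → Matrix (Fin m) (Fin m) ℝ} :
    ContDiff ℝ n c ↔ ∀ i j, ContDiff ℝ n (fun t => c t i j) := by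
  constructor
  · intro h i j
    exact (LinearMap.toContinuousLinearMap (entryLinearMap ℝ ℝ i j)).contDiff.comp h
  · intro h
    have : c = fun t => ∑ i, ∑ j, c t i j • single i j (1 : ℝ) := by
      ext1 t
      conv_lhs => rw [matrix_eq_sum_single (c t)]
      simp
    rw [this]
    exact ContDiff.sum fun i _ => ContDiff.sum fun j _ => (h i j).smul contDiff_const

theorem velocity_eq_of_hasDerivAt {c : ℝ → Matrix (Fin m) (Fin m) ℝ}
    {V : Matrix (Fin m) (Fin m) ℝ} {t : ℝ} (h : HasDerivAt c V t) : velocity c t = V := by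
  ext i j
  exact ((LinearMap.toContinuousLinearMap (entryLinearMap ℝ ℝ i j)).hasFDerivAt.comp_hasDerivAt
    t h).deriv

theorem hasDerivAt_velocity {c : ℝ → Matrix (Fin m) (Fin m) ℝ} (hc : ContDiff ℝ ∞ c) (t : ℝ) :
    HasDerivAt c (velocity c t) t := by
  have h : HasDerivAt c (deriv c t) t :=
    (hc.differentiable (by simp)).differentiableAt.hasDerivAt
  rwa [velocity_eq_of_hasDerivAt h]

theorem contDiff_velocity {c : ℝ → Matrix (Fin m) (Fin m) ℝ} (hc : ContDiff ℝ ∞ c) :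
    ContDiff ℝ ∞ (velocity c) := by
  have h : velocity c = deriv c := funext fun t => (hasDerivAt_velocity hc t).deriv.symm
  rw [h]
  exact (contDiff_infty_iff_deriv.mp hc).2

theorem isUnit_det_of_mem_symSpace {P : Matrix (Fin m) (Fin m) ℝ} (hP : P ∈ symSpace m) :
    IsUnit P.det := by rw [hP.2]; exact isUnit_one

theorem transpose_eq_of_mem_symSpace {P : Matrix (Fin m) (Fin m) ℝ} (hP : P ∈ symSpace m) :
    Pᵀ = P := by
  have := hP.1.isHermitian
  rwa [IsHermitian, conjTranspose_eq_transpose_of_trivial] at this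

theorem contDiff_inv {c : ℝ → Matrix (Fin m) (Fin m) ℝ} (hc : ContDiff ℝ ∞ c)
    (hmem : ∀ t, c t ∈ symSpace m) : ContDiff ℝ ∞ (fun t => (c t)⁻¹) := by
  simp_rw [nonsing_inv_eq_ringInverse]
  rw [contDiff_iff_contDiffAt]
  intro t
  obtain ⟨u, hu⟩ := (isUnit_iff_isUnit_det (c t)).mpr (isUnit_det_of_mem_symSpace (hmem t))
  have := contDiffAt_ringInverse ℝ (n := ∞) u
  rw [hu] at this
  exact this.comp t hc.contDiffAt

theorem velocity_transpose {c : ℝ → Matrix (Fin m) (Fin m) ℝ} (hmem : ∀ t, c t ∈ symSpace m)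
    (t : ℝ) : (velocity c t)ᵀ = velocity c t := by
  ext i j
  have : (fun s => c s j i) = fun s => c s i j := by
    ext s
    exact congrFun (congrFun (transpose_eq_of_mem_symSpace (hmem s)) i) j
  simp only [velocity, transpose_apply, of_apply, this]

theorem continuous_riemMetric {c V W : ℝ → Matrix (Fin m) (Fin m) ℝ} (hc : ContDiff ℝ ∞ c)
    (hmem : ∀ t, c t ∈ symSpace m) (hV : Continuous V) (hW : Continuous W) :
    Continuous fun t => riemMetric (c t) (V t) (W t) := by
  have hi := (contDiff_inv hc hmem).continuous
  unfold riemMetric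
  exact continuous_const.mul ((((hi.mul hV).mul hi).mul hW).matrix_trace)

/-- The logarithm of a quadratic form varies along a curve by at most twice its length. -/
theorem abs_log_sub_log_le {c : ℝ → Matrix (Fin m) (Fin m) ℝ} (hc : ContDiff ℝ ∞ c)
    (hmem : ∀ t, c t ∈ symSpace m) {w : Fin m → ℝ} (hw : w ≠ 0) :
    |Real.log (w ⬝ᵥ c 1 *ᵥ w) - Real.log (w ⬝ᵥ c 0 *ᵥ w)| ≤ 2 * curveLength c 0 1 := by
  have hpos : ∀ t, 0 < w ⬝ᵥ c t *ᵥ w := fun t => by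
    simpa using (hmem t).1.dotProduct_mulVec_pos hw
  let ℓ : Matrix (Fin m) (Fin m) ℝ →ₗ[ℝ] ℝ :=
    { toFun := fun X => w ⬝ᵥ X *ᵥ w
      map_add' := fun X Y => by simp [add_mulVec]
      map_smul' := fun r X => by simp [smul_mulVec] }
  have hd : ∀ t, HasDerivAt (fun s => w ⬝ᵥ c s *ᵥ w) (w ⬝ᵥ velocity c t *ᵥ w) t := fun t =>
    (LinearMap.toContinuousLinearMap ℓ).hasFDerivAt.comp_hasDerivAt t (hasDerivAt_velocity hc t)
  have hlog : ∀ t, HasDerivAt (fun s => Real.log (w ⬝ᵥ c s *ᵥ w))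
      ((w ⬝ᵥ velocity c t *ᵥ w) / (w ⬝ᵥ c t *ᵥ w)) t := fun t => (hd t).log (hpos t).ne'
  have hcv : Continuous (velocity c) := (contDiff_velocity hc).continuous
  have hcq : Continuous fun t => w ⬝ᵥ c t *ᵥ w :=
    (LinearMap.toContinuousLinearMap ℓ).continuous.comp hc.continuous
  have hcq' : Continuous fun t => w ⬝ᵥ velocity c t *ᵥ w :=
    (LinearMap.toContinuousLinearMap ℓ).continuous.comp hcv
  have hcs : Continuous fun t => 2 * √(riemMetric (c t) (velocity c t) (velocity c t)) :=
    continuous_const.mul (continuous_riemMetric hc hmem hcv hcv).sqrt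
  rw [← intervalIntegral.integral_eq_sub_of_hasDerivAt (fun t _ => hlog t)
    ((hcq'.div hcq fun t => (hpos t).ne').intervalIntegrable 0 1), curveLength,
    ← intervalIntegral.integral_const_mul, ← Real.norm_eq_abs]
  refine intervalIntegral.norm_integral_le_of_norm_le zero_le_one ?_ (hcs.intervalIntegrable 0 1)
  refine Eventually.of_forall fun t _ => ?_
  rw [Real.norm_eq_abs, abs_div, abs_of_pos (hpos t), div_le_iff₀ (hpos t)]
  exact abs_dotProduct_mulVec_le (hmem t).1 (velocity_transpose hmem t) w

theorem dotProduct_mulVec_le_exp {c : ℝ → Matrix (Fin m) (Fin m) ℝ} (hc : ContDiff ℝ ∞ c)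
    (hmem : ∀ t, c t ∈ symSpace m) (w : Fin m → ℝ) :
    w ⬝ᵥ c 1 *ᵥ w ≤ Real.exp (curveLength c 0 1) ^ 2 * (w ⬝ᵥ c 0 *ᵥ w) ∧
      w ⬝ᵥ c 0 *ᵥ w ≤ Real.exp (curveLength c 0 1) ^ 2 * (w ⬝ᵥ c 1 *ᵥ w) := by
  rcases eq_or_ne w 0 with rfl | hw
  · simp
  have hpos : ∀ t, 0 < w ⬝ᵥ c t *ᵥ w := fun t => by
    simpa using (hmem t).1.dotProduct_mulVec_pos hw
  have h := abs_le.mp (abs_log_sub_log_le hc hmem hw)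
  have key : ∀ a b : ℝ, 0 < a → 0 < b → Real.log a - Real.log b ≤ 2 * curveLength c 0 1 →
      a ≤ Real.exp (curveLength c 0 1) ^ 2 * b := by
    intro a b ha hb hab
    rw [← Real.exp_nat_mul, ← Real.log_le_log_iff ha (by positivity),
      Real.log_mul (Real.exp_pos _).ne' hb.ne', Real.log_exp]
    push_cast
    linarith
  exact ⟨key _ _ (hpos 1) (hpos 0) h.2, key _ _ (hpos 0) (hpos 1) (by linarith [h.1])⟩

/-- A smooth function orthogonal to the derivatives of all test functions is constant. -/
theorem deriv_eq_zero_of_forall_integral {f : ℝ → ℝ} (hf : ContDiff ℝ ∞ f)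
    (h : ∀ a b, a < b → ∀ φ : ℝ → ℝ, ContDiff ℝ ∞ φ → (∀ t, t ∉ Set.Ioo a b → φ t = 0) →
      ∫ t in a..b, deriv φ t * f t = 0) (t : ℝ) : deriv f t = 0 := by
  by_contra hne
  let ψ : ContDiffBump t := ⟨1 / 2, 1, by norm_num, by norm_num⟩
  have hf' : ContDiff ℝ ∞ (deriv f) := (contDiff_infty_iff_deriv.mp hf).2
  -- Testing against a bump times `f'` and integrating by parts gives `∫ ψ f'² = 0`, which is
  -- impossible if `f' t ≠ 0`.
  have hφ : ContDiff ℝ ∞ (fun s => ψ s * deriv f s) := ψ.contDiff.mul hf'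
  have hφ' := (contDiff_infty_iff_deriv.mp hφ).2
  have h0 : ∀ s, s ∉ Set.Ioo (t - 1) (t + 1) → ψ s * deriv f s = 0 := by
    intro s hs
    have : ψ s = 0 := by
      refine ψ.zero_of_le_dist ?_
      rw [Real.dist_eq]
      by_contra hlt
      rw [not_le, abs_lt] at hlt
      have h1 : ψ.rOut = 1 := rfl
      rw [h1] at hlt
      exact hs ⟨by linarith, by linarith⟩
    rw [this, zero_mul]
  have h1 := h (t - 1) (t + 1) (by linarith) _ hφ h0
  have h2 := intervalIntegral.integral_mul_deriv_eq_deriv_mul (a := t - 1) (b := t + 1)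
    (u := fun s => ψ s * deriv f s) (v := f) (u' := deriv fun s => ψ s * deriv f s)
    (v' := deriv f)
    (fun s _ => (hφ.differentiable (by simp)).differentiableAt.hasDerivAt)
    (fun s _ => (hf.differentiable (by simp)).differentiableAt.hasDerivAt)
    (hφ'.continuous.intervalIntegrable _ _) (hf'.continuous.intervalIntegrable _ _)
  rw [h1, h0 (t + 1) (by simp), h0 (t - 1) (by simp)] at h2
  have h3 : 0 < ∫ s in (t - 1)..(t + 1), ψ s * deriv f s * deriv f s := by
    refine intervalIntegral.integral_pos (by linarith)
      (hφ.continuous.mul hf'.continuous).continuousOn (fun s _ => ?_)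
      ⟨t, ⟨by linarith, by linarith⟩, ?_⟩
    · rw [mul_assoc]
      exact mul_nonneg ψ.nonneg (mul_self_nonneg _)
    · rw [mul_assoc]
      have : ψ t = 1 := ψ.one_of_mem_closedBall (by simp [ψ.rIn_pos.le])
      rw [this, one_mul]
      exact mul_self_pos.mpr hne
  rw [h2] at h3
  simp at h3

theorem riemMetric_conj {P G V W : Matrix (Fin m) (Fin m) ℝ} (hG : IsUnit G.det) :
    riemMetric (G * P * Gᵀ) (G * V * Gᵀ) (G * W * Gᵀ) = riemMetric P V W := by
  have hG' : IsUnit Gᵀ.det := by rwa [det_transpose]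
  have h2 : G⁻¹ * G = 1 := nonsing_inv_mul _ hG
  have h3 : Gᵀ * Gᵀ⁻¹ = 1 := mul_nonsing_inv _ hG'
  unfold riemMetric
  rw [Matrix.mul_inv_rev, Matrix.mul_inv_rev]
  have e : Gᵀ⁻¹ * (P⁻¹ * G⁻¹) * (G * V * Gᵀ) * (Gᵀ⁻¹ * (P⁻¹ * G⁻¹)) * (G * W * Gᵀ) =
      Gᵀ⁻¹ * (P⁻¹ * V * P⁻¹ * W * Gᵀ) := by
    calc _ = Gᵀ⁻¹ * (P⁻¹ * (G⁻¹ * G) * V * (Gᵀ * Gᵀ⁻¹) * P⁻¹ * (G⁻¹ * G) * W * Gᵀ) := by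
          noncomm_ring
      _ = _ := by rw [h2, h3]; noncomm_ring
  rw [e, trace_mul_comm, Matrix.mul_assoc, h3, Matrix.mul_one]

/-- The vector `A P + P Aᵀ` is the infinitesimal action of `A` at `P`, so the pairing exhibits `V
P⁻¹` as the momentum of the group action. -/
theorem riemMetric_infinitesimal {P V A : Matrix (Fin m) (Fin m) ℝ} (hP : P ∈ symSpace m)
    (hV : Vᵀ = V) : riemMetric P V (A * P + P * Aᵀ) = 1 / 2 * (V * P⁻¹ * A).trace := by
  have hu := isUnit_det_of_mem_symSpace hP
  have h1 : P * P⁻¹ = 1 := mul_nonsing_inv _ hu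
  have h2 : P⁻¹ * P = 1 := nonsing_inv_mul _ hu
  have hPi : (P⁻¹)ᵀ = P⁻¹ := by rw [transpose_nonsing_inv, transpose_eq_of_mem_symSpace hP]
  have e1 : (P⁻¹ * V * P⁻¹ * (A * P)).trace = (V * P⁻¹ * A).trace := by
    rw [← Matrix.mul_assoc, trace_mul_comm]
    congr 1
    calc _ = (P * P⁻¹) * V * P⁻¹ * A := by noncomm_ring
      _ = _ := by rw [h1]; noncomm_ring
  have e2 : (P⁻¹ * V * P⁻¹ * (P * Aᵀ)).trace = (V * P⁻¹ * A).trace := by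
    rw [← trace_transpose, trace_mul_comm (V * P⁻¹) A]
    congr 1
    calc _ = (P⁻¹ * V * (P⁻¹ * P) * Aᵀ)ᵀ := by congr 1; noncomm_ring
      _ = _ := by rw [h2]; simp [hPi, hV, Matrix.mul_assoc]
  rw [riemMetric, Matrix.mul_add, trace_add, e1, e2]
  ring

theorem riemMetric_comm (P V W : Matrix (Fin m) (Fin m) ℝ) :
    riemMetric P V W = riemMetric P W V := by
  unfold riemMetric
  rw [Matrix.mul_assoc, trace_mul_comm, ← Matrix.mul_assoc]

theorem riemMetric_add_smul (P V K : Matrix (Fin m) (Fin m) ℝ) (r : ℝ) :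
    riemMetric P (V + r • K) (V + r • K) =
      riemMetric P V V + r * (2 * riemMetric P V K) + r ^ 2 * riemMetric P K K := by
  have hc := riemMetric_comm P V K
  unfold riemMetric at *
  simp only [Matrix.mul_add, Matrix.add_mul, trace_add, Matrix.mul_smul, Matrix.smul_mul,
    trace_smul, smul_eq_mul]
  linear_combination (-r) * hc

theorem det_one_add_smul_vecMulVec {u w : Fin m → ℝ} (h : w ⬝ᵥ u = 0) (r : ℝ) :
    (1 + r • vecMulVec u w).det = 1 := by
  rw [← smul_vecMulVec, vecMulVec_eq Unit, det_one_add_replicateCol_mul_replicateRow]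
  simp [h]

theorem mem_symSpace_conj {P G : Matrix (Fin m) (Fin m) ℝ} (hP : P ∈ symSpace m)
    (hG : G.det = 1) : G * P * Gᵀ ∈ symSpace m := by
  refine ⟨?_, by simp [hG, hP.2]⟩
  have := hP.1.mul_mul_conjTranspose_same (B := G) (by
    rw [vecMul_injective_iff_isUnit, isUnit_iff_isUnit_det, hG]
    exact isUnit_one)
  rwa [conjTranspose_eq_transpose_of_trivial] at this

/-- Noether's theorem: the momentum `c' c⁻¹` of a geodesic in the direction of a nilpotent
matrix of rank one is conserved. -/
theorem integral_deriv_mul_trace_eq_zero {c : ℝ → Matrix (Fin m) (Fin m) ℝ} (hc : IsGeodesic c)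
    {u w : Fin m → ℝ} (huw : w ⬝ᵥ u = 0) {a b : ℝ} (hab : a < b) {φ : ℝ → ℝ}
    (hφ : ContDiff ℝ ∞ φ) (hφ0 : ∀ t, t ∉ Set.Ioo a b → φ t = 0) :
    ∫ t in a..b, deriv φ t * (velocity c t * (c t)⁻¹ * vecMulVec u w).trace = 0 := by
  have hcs : ContDiff ℝ ∞ c := contDiff_matrix.mpr hc.smooth
  set A := vecMulVec u w with hA
  have hAA : A * A = 0 := by rw [hA, vecMulVec_mul_vecMulVec, huw]; simp
  -- The variation moves `c` by the one-parameter group of `A`, with time-dependent parameter `s φ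
  -- t`. Since `A² = 0` this group is affine in `s`, and the energy becomes a quadratic polynomial
  -- in `s`.
  set G : ℝ → ℝ → Matrix (Fin m) (Fin m) ℝ := fun s t => 1 + (s * φ t) • A with hG
  have hGdet : ∀ s t, (G s t).det = 1 := fun s t => det_one_add_smul_vecMulVec huw _
  have hGu : ∀ s t, IsUnit (G s t).det := fun s t => by rw [hGdet]; exact isUnit_one
  have hvar : IsVariation c a b fun s t => G s t * c t * (G s t)ᵀ := by
    refine ⟨fun s t => mem_symSpace_conj (hc.mem t) (hGdet s t), ?_, fun t => by simp [hG],
      fun s t ht => by simp [hG, hφ0 t ht]⟩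
    rw [← contDiff_matrix]
    have h1 : ContDiff ℝ ∞ fun z : ℝ × ℝ => z.1 * φ z.2 := contDiff_fst.mul (hφ.comp contDiff_snd)
    have h2 : ContDiff ℝ ∞ fun z : ℝ × ℝ => G z.1 z.2 :=
      contDiff_const.add (h1.smul contDiff_const)
    have h3 : ContDiff ℝ ∞ fun z : ℝ × ℝ => (G z.1 z.2)ᵀ :=
      contDiff_matrix.mpr fun i j => contDiff_matrix.mp h2 j i
    exact (h2.mul (hcs.comp contDiff_snd)).mul h3
  set K : ℝ → Matrix (Fin m) (Fin m) ℝ := fun t => A * c t + c t * Aᵀ with hK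
  have hvel : ∀ s t, velocity (fun t => G s t * c t * (G s t)ᵀ) t =
      G s t * (velocity c t + (s * deriv φ t) • K t) * (G s t)ᵀ := by
    intro s t
    have h1 : HasDerivAt (fun t => s * φ t) (s * deriv φ t) t :=
      (hφ.differentiable (by simp)).differentiableAt.hasDerivAt.const_mul s
    have h2 : HasDerivAt (fun t => G s t) ((s * deriv φ t) • A) t :=
      (h1.smul_const A).const_add 1
    have h3 : HasDerivAt (fun t => (G s t)ᵀ) ((s * deriv φ t) • Aᵀ) t := by
      have : (fun t => (G s t)ᵀ) = fun t => 1 + (s * φ t) • Aᵀ := by ext1 t; simp [hG]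
      rw [this]
      exact (h1.smul_const Aᵀ).const_add 1
    have h4 : HasDerivAt (fun t => G s t * c t * (G s t)ᵀ) _ t :=
      (h2.mul (hasDerivAt_velocity hcs t)).mul h3
    rw [velocity_eq_of_hasDerivAt h4]
    have hAG : A = G s t * A := by simp [hG, Matrix.add_mul, hAA]
    have hAG' : Aᵀ = Aᵀ * (G s t)ᵀ := by rw [← transpose_mul, ← hAG]
    simp only [hK]
    calc _ = (s * deriv φ t) • (A * c t * (G s t)ᵀ) + G s t * velocity c t * (G s t)ᵀ
          + (s * deriv φ t) • (G s t * c t * Aᵀ) := by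
          simp only [Pi.mul_apply, Matrix.add_mul, Matrix.smul_mul, Matrix.mul_smul]
      _ = (s * deriv φ t) • ((G s t * A) * c t * (G s t)ᵀ) + G s t * velocity c t * (G s t)ᵀ
          + (s * deriv φ t) • (G s t * c t * (Aᵀ * (G s t)ᵀ)) := by rw [← hAG, ← hAG']
      _ = _ := by
        simp only [Matrix.mul_add, Matrix.add_mul, Matrix.smul_mul, Matrix.mul_smul, smul_add,
          Matrix.mul_assoc]
        abel
  have hcv := (contDiff_velocity hcs).continuous
  have hKc : Continuous K :=
    (continuous_const.mul hcs.continuous).add (hcs.continuous.mul continuous_const)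
  have hφ' : Continuous (deriv φ) := (contDiff_infty_iff_deriv.mp hφ).2.continuous
  have hcA := continuous_riemMetric hcs hc.mem hcv hcv
  have hcB : Continuous fun t => deriv φ t * (2 * riemMetric (c t) (velocity c t) (K t)) :=
    hφ'.mul (continuous_const.mul (continuous_riemMetric hcs hc.mem hcv hKc))
  have hcC : Continuous fun t => deriv φ t ^ 2 * riemMetric (c t) (K t) (K t) :=
    (hφ'.pow 2).mul (continuous_riemMetric hcs hc.mem hKc hKc)
  have hen : ∀ s, curveEnergy (fun t => G s t * c t * (G s t)ᵀ) a b =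
      1 / 2 * ((∫ t in a..b, riemMetric (c t) (velocity c t) (velocity c t)) +
        s * (∫ t in a..b, deriv φ t * (2 * riemMetric (c t) (velocity c t) (K t))) +
        s ^ 2 * ∫ t in a..b, deriv φ t ^ 2 * riemMetric (c t) (K t) (K t)) := by
    intro s
    have hcAB : Continuous fun t => riemMetric (c t) (velocity c t) (velocity c t) +
        s * (deriv φ t * (2 * riemMetric (c t) (velocity c t) (K t))) :=
      hcA.add (hcB.const_mul s)
    unfold curveEnergy
    congr 1
    rw [← intervalIntegral.integral_const_mul, ← intervalIntegral.integral_const_mul,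
      ← intervalIntegral.integral_add (hcA.intervalIntegrable _ _)
        ((hcB.const_mul s).intervalIntegrable _ _),
      ← intervalIntegral.integral_add (hcAB.intervalIntegrable _ _)
        ((hcC.const_mul (s ^ 2)).intervalIntegrable _ _)]
    refine intervalIntegral.integral_congr fun t _ => ?_
    simp only
    rw [hvel, riemMetric_conj (hGu s t), riemMetric_add_smul]
    ring
  have hder := hc.critical a b hab _ hvar
  simp only [hen] at hder
  have hder2 : ∀ E₀ E₁ E₂ : ℝ,
      HasDerivAt (fun s : ℝ => 1 / 2 * (E₀ + s * E₁ + s ^ 2 * E₂)) (1 / 2 * E₁) 0 := by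
    intro E₀ E₁ E₂
    have h1 := ((hasDerivAt_id (0 : ℝ)).mul_const E₁).const_add E₀
    have h2 := ((hasDerivAt_id (0 : ℝ)).pow 2).mul_const E₂
    refine ((h1.add h2).const_mul (1 / 2)).congr_deriv ?_
    simp
  have h0 := (hder2 _ _ _).unique hder
  have e : ∀ t, 2 * riemMetric (c t) (velocity c t) (K t) =
      (velocity c t * (c t)⁻¹ * A).trace := fun t => by
    rw [hK, riemMetric_infinitesimal (hc.mem t) (velocity_transpose hc.mem t)]; ring
  simp only [e] at h0
  linarith

end Curves

/-! ### Consequences for an isometry with an axis -/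

section Axes

attribute [local instance] Matrix.linftyOpNormedAddCommGroup Matrix.linftyOpNormedSpace
  Matrix.linftyOpNormedRing Matrix.linftyOpNormedAlgebra

variable {m : ℕ}

theorem isUnit_det_val (γ : Matrix.SpecialLinearGroup (Fin m) ℝ) : IsUnit γ.val.det := by
  rw [γ.2]; exact isUnit_one

theorem velocity_translate {γ : Matrix.SpecialLinearGroup (Fin m) ℝ}
    {c : ℝ → Matrix (Fin m) (Fin m) ℝ} (hc : IsAxis γ c) (t : ℝ) :
    γ.val * velocity c t * γ.valᵀ = velocity c (t + 1) := by
  have hcs : ContDiff ℝ ∞ c := contDiff_matrix.mpr hc.geodesic.smooth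
  have h1 : HasDerivAt (fun s => γ.val * c s * γ.valᵀ) (γ.val * velocity c t * γ.valᵀ) t :=
    ((hasDerivAt_velocity hcs t).const_mul γ.val).mul_const γ.valᵀ
  have h2 : HasDerivAt (fun s => c (s + 1)) (velocity c (t + 1)) t :=
    (hasDerivAt_velocity hcs (t + 1)).comp_add_const t 1
  simp only [hc.translate] at h1
  exact h1.unique h2

theorem momentum_translate {γ : Matrix.SpecialLinearGroup (Fin m) ℝ}
    {c : ℝ → Matrix (Fin m) (Fin m) ℝ} (hc : IsAxis γ c) (t : ℝ) :
    γ.val * (velocity c t * (c t)⁻¹) * γ.val⁻¹ = velocity c (t + 1) * (c (t + 1))⁻¹ := by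
  have hγ' : IsUnit γ.valᵀ.det := by rw [det_transpose]; exact isUnit_det_val γ
  rw [← velocity_translate hc, ← hc.translate, Matrix.mul_inv_rev, Matrix.mul_inv_rev]
  calc _ = γ.val * velocity c t * 1 * (c t)⁻¹ * γ.val⁻¹ := by noncomm_ring
    _ = γ.val * velocity c t * (γ.valᵀ * γ.valᵀ⁻¹) * (c t)⁻¹ * γ.val⁻¹ := by
      rw [mul_nonsing_inv _ hγ']
    _ = _ := by noncomm_ring

/-- Translation along the axis conjugates the momentum by `γ`, while Noether's theorem says that it
does not change. -/
theorem commute_momentum {γ : Matrix.SpecialLinearGroup (Fin m) ℝ}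
    {c : ℝ → Matrix (Fin m) (Fin m) ℝ} (hc : IsAxis γ c) (t : ℝ) :
    γ.val * (velocity c t * (c t)⁻¹) = velocity c t * (c t)⁻¹ * γ.val := by
  have hcs : ContDiff ℝ ∞ c := contDiff_matrix.mpr hc.geodesic.smooth
  have hmem := hc.geodesic.mem
  have hγ1 : γ.val⁻¹ * γ.val = 1 := nonsing_inv_mul _ (isUnit_det_val γ)
  have hQ : ContDiff ℝ ∞ fun s => velocity c s * (c s)⁻¹ :=
    (contDiff_velocity hcs).mul (contDiff_inv hcs hmem)
  -- Conservation is known only against rank-one nilpotents, which detect trace-free matrices; the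
  -- difference is trace-free because the two momenta are conjugate.
  have key : velocity c (t + 1) * (c (t + 1))⁻¹ - velocity c t * (c t)⁻¹ = 0 := by
    apply eq_zero_of_trace_mul_vecMulVec_eq_zero
    · rw [← momentum_translate hc, trace_sub, trace_mul_comm, ← Matrix.mul_assoc, hγ1,
        Matrix.one_mul, sub_self]
    · intro u w huw
      have hf : ContDiff ℝ ∞ fun s => (velocity c s * (c s)⁻¹ * vecMulVec u w).trace :=
        (LinearMap.toContinuousLinearMap (traceLinearMap (Fin m) ℝ ℝ)).contDiff.comp
          (hQ.mul contDiff_const)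
      have hconst := is_const_of_deriv_eq_zero (hf.differentiable (by simp))
        (deriv_eq_zero_of_forall_integral hf fun a b hab φ hφ hφ0 =>
          integral_deriv_mul_trace_eq_zero hc.geodesic huw hab hφ hφ0) (t + 1) t
      rw [Matrix.sub_mul, trace_sub, hconst, sub_self]
  rw [sub_eq_zero, ← momentum_translate hc] at key
  calc _ = γ.val * (velocity c t * (c t)⁻¹) * (γ.val⁻¹ * γ.val) := by
        rw [hγ1, Matrix.mul_one]
    _ = γ.val * (velocity c t * (c t)⁻¹) * γ.val⁻¹ * γ.val := by noncomm_ring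
    _ = _ := by rw [key]

/-- Put `Z = c⁻¹ γ c` and differentiate `c Z = γ c`. Since `γ` commutes with `c' c⁻¹`, one has `c' Z
= γ c'`, which leaves `c Z' = 0`. -/
theorem inv_mul_mul_eq {γ : Matrix.SpecialLinearGroup (Fin m) ℝ}
    {c : ℝ → Matrix (Fin m) (Fin m) ℝ} (hc : IsAxis γ c) :
    (c 1)⁻¹ * γ.val * c 1 = (c 0)⁻¹ * γ.val * c 0 := by
  have hcs : ContDiff ℝ ∞ c := contDiff_matrix.mpr hc.geodesic.smooth
  have hmem := hc.geodesic.mem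
  have hZ : ContDiff ℝ ∞ fun t => (c t)⁻¹ * γ.val * c t :=
    ((contDiff_inv hcs hmem).mul contDiff_const).mul hcs
  have hZd := hZ.differentiable (by simp)
  refine is_const_of_deriv_eq_zero hZd (fun t => ?_) 1 0
  have h2 : (c t)⁻¹ * (c t) = 1 := nonsing_inv_mul _ (isUnit_det_of_mem_symSpace (hmem t))
  have hcZ : ∀ s, c s * ((c s)⁻¹ * γ.val * c s) = γ.val * c s := fun s => by
    rw [← Matrix.mul_assoc, ← Matrix.mul_assoc,
      mul_nonsing_inv _ (isUnit_det_of_mem_symSpace (hmem s)), Matrix.one_mul]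
  have hd1 : HasDerivAt (fun s => c s * ((c s)⁻¹ * γ.val * c s)) _ t :=
    (hasDerivAt_velocity hcs t).mul hZd.differentiableAt.hasDerivAt
  have hd2 := (hasDerivAt_velocity hcs t).const_mul γ.val
  simp only [hcZ] at hd1
  have h3 := hd1.unique hd2
  have h4 : velocity c t * ((c t)⁻¹ * γ.val * c t) = γ.val * velocity c t := by
    calc _ = (velocity c t * (c t)⁻¹ * γ.val) * c t := by noncomm_ring
      _ = γ.val * velocity c t * ((c t)⁻¹ * c t) := by
        rw [← commute_momentum hc]; noncomm_ring
      _ = _ := by rw [h2, Matrix.mul_one]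
  rw [h4, add_eq_left] at h3
  have h5 : ∀ D : Matrix (Fin m) (Fin m) ℝ, c t * D = 0 → D = 0 := fun D hD => by
    rw [← Matrix.one_mul D, ← h2, Matrix.mul_assoc, hD, Matrix.mul_zero]
  exact h5 _ h3

/-- A nontrivial unipotent isometry has no axis and no fixed point. -/
theorem IsAxis.eq_one_of_isNilpotent {γ : Matrix.SpecialLinearGroup (Fin m) ℝ}
    {c : ℝ → Matrix (Fin m) (Fin m) ℝ} (hc : IsAxis γ c) (hγ : IsNilpotent (γ.val - 1)) :
    γ = 1 := by
  have hmem := hc.geodesic.mem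
  have hγu := isUnit_det_val γ
  have hγ' : IsUnit γ.valᵀ.det := by rw [det_transpose]; exact hγu
  apply Subtype.ext
  refine eq_one_of_isNilpotent_of_commute (hmem 0).1 hγ ?_
  have h := inv_mul_mul_eq hc
  have h1 : c 1 = γ.val * c 0 * γ.valᵀ := by rw [hc.translate, zero_add]
  rw [h1, Matrix.mul_inv_rev, Matrix.mul_inv_rev] at h
  have hγ1 : γ.val⁻¹ * γ.val = 1 := nonsing_inv_mul _ hγu
  -- Substituting `c 1 = γ (c 0) γᵀ` turns the constancy of `c⁻¹ γ c` into its commutation with `γᵀ`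
  -- at time 0.
  have hγ2 : γ.valᵀ * γ.valᵀ⁻¹ = 1 := mul_nonsing_inv _ hγ'
  rw [Commute, SemiconjBy, ← h]
  calc _ = (γ.valᵀ * γ.valᵀ⁻¹) * (c 0)⁻¹ * (γ.val⁻¹ * γ.val) * γ.val * c 0 * γ.valᵀ := by
        noncomm_ring
    _ = (c 0)⁻¹ * γ.val * c 0 * γ.valᵀ := by rw [hγ1, hγ2]; noncomm_ring
    _ = _ := by rw [h]

theorem IsAxis.abs_eval_charpoly_le {γ : Matrix.SpecialLinearGroup (Fin m) ℝ}
    {c : ℝ → Matrix (Fin m) (Fin m) ℝ} (hc : IsAxis γ c) (x : ℝ) :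
    |γ.val.charpoly.eval x| ≤ m.factorial * (|x| + Real.exp (curveLength c 0 1)) ^ m ∧
      |γ⁻¹.val.charpoly.eval x| ≤ m.factorial * (|x| + Real.exp (curveLength c 0 1)) ^ m := by
  have hcs : ContDiff ℝ ∞ c := contDiff_matrix.mpr hc.geodesic.smooth
  have hmem := hc.geodesic.mem
  have h1 : γ.val * c 0 * γ.valᵀ = c 1 := by rw [hc.translate, zero_add]
  have h2 : γ⁻¹.val * c 1 * γ⁻¹.valᵀ = c 0 := by
    have e : γ⁻¹.val * γ.val = 1 := by
      rw [← Matrix.SpecialLinearGroup.coe_mul, inv_mul_cancel, Matrix.SpecialLinearGroup.coe_one]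
    rw [← h1]
    calc _ = (γ⁻¹.val * γ.val) * c 0 * (γ⁻¹.val * γ.val)ᵀ := by
          rw [transpose_mul]; noncomm_ring
      _ = _ := by rw [e]; simp
  constructor
  · refine SystoleGrowth.abs_eval_charpoly_le (hmem 0).1 (Real.exp_pos _).le fun w => ?_
    rw [h1]
    exact (dotProduct_mulVec_le_exp hcs hmem w).1
  · refine SystoleGrowth.abs_eval_charpoly_le (hmem 1).1 (Real.exp_pos _).le fun w => ?_
    rw [h2]
    exact (dotProduct_mulVec_le_exp hcs hmem w).2

end Axes

/-- A bound for the level of a congruence subgroup with an axis of length at most `L`. -/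
theorem level_le_of_isAxis {d m : ℕ} {τ : quadField d ≃ₐ[ℚ] quadField d}
    (hτ : τ ≠ 1) {J : Matrix (Fin m) (Fin m) (quadField d)} (hJ : J.det ≠ 0) {p : ℕ}
    {γ : Matrix.SpecialLinearGroup (Fin m) ℝ}
    (hγ : γ ∈ (principalCongruence (integralSpecialUnitary τ J) p).map
      (integralToReal (quadField d) m)) (hγ1 : γ ≠ 1)
    {c : ℝ → Matrix (Fin m) (Fin m) ℝ} (hc : IsAxis γ c) {L : ℝ} (hL : curveLength c 0 1 ≤ L) :
    (p : ℝ) ≤ m.factorial * (m + Real.exp L) ^ m + (m + 1) ^ m := by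
  obtain ⟨M, hM, rfl⟩ := hγ
  have hex : ∃ x ∈ Finset.range (m + 1),
      (integralToReal (quadField d) m M).val.charpoly.eval (x : ℝ) ≠ ((x : ℝ) - 1) ^ m := by
    by_contra! hall
    exact hγ1 (hc.eq_one_of_isNilpotent (isNilpotent_sub_one_of_charpoly
      (charpoly_eq_of_forall_eval hall)))
  obtain ⟨x, hxm, hx⟩ := hex
  have hxm' : (x : ℝ) ≤ m := by
    exact_mod_cast Nat.lt_succ_iff.mp (Finset.mem_range.mp hxm)
  have hb : ∀ A : ℝ, |A| ≤ m.factorial * (|(x : ℝ)| + Real.exp (curveLength c 0 1)) ^ m →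
      |A - ((x : ℝ) - 1) ^ m| ≤ m.factorial * (m + Real.exp L) ^ m + (m + 1) ^ m := by
    intro A hA
    refine (abs_sub _ _).trans (add_le_add (hA.trans ?_) ?_)
    · rw [Nat.abs_cast]
      gcongr
    · rw [abs_pow]
      gcongr
      rw [abs_le]
      have : (0 : ℝ) ≤ x := Nat.cast_nonneg x
      constructor <;> linarith
  have h := hc.abs_eval_charpoly_le x
  refine le_of_sq_le_sq ?_ (by positivity)
  calc (p : ℝ) ^ 2 ≤ _ := sq_le_of_mem_principalCongruence hτ hJ hM x hx
    _ ≤ _ := mul_le_mul (hb _ h.1) (hb _ h.2) (abs_nonneg _) (by positivity)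
    _ = _ := (sq _).symm

end SystoleGrowth

theorem mainTheorem2 (d : ℕ) (hd : 2 ≤ d) (hsq : Squarefree d)
    (τ : SystoleGrowth.quadField d ≃ₐ[ℚ] SystoleGrowth.quadField d) (hτ : τ ≠ 1)
    (m : ℕ)
    (J : ℕ → Matrix (Fin m) (Fin m) (SystoleGrowth.quadField d))
    (hJ : ∀ n, SystoleGrowth.IsTauHermitian τ (J n))
    (hJdet : ∀ n, (J n).det ≠ 0)
    (p : ℕ → ℕ) (hp : ∀ n, (p n).Prime) (hp_lim : Tendsto p atTop atTop) :
    Tendsto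
      (fun n => SystoleGrowth.systole
        ((SystoleGrowth.principalCongruence
            (SystoleGrowth.integralSpecialUnitary τ (J n)) (p n)).map
          (SystoleGrowth.integralToReal (SystoleGrowth.quadField d) m)))
      atTop (𝓝 ⊤) := by
  refine ENNReal.tendsto_nhds_top fun N => ?_
  have hp' : Tendsto (fun n => (p n : ℝ)) atTop atTop := tendsto_natCast_atTop_atTop.comp hp_lim
  filter_upwards [hp'.eventually_gt_atTop
    (m.factorial * (m + Real.exp (N + 1 : ℕ)) ^ m + (m + 1) ^ m)] with n hn
  refine lt_of_lt_of_le (b := ((N + 1 : ℕ) : ℝ≥0∞)) (by exact_mod_cast Nat.lt_succ_self N) ?_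
  refine le_sInf ?_
  rintro l ⟨γ, hγ, hγ1, c, hc, rfl⟩
  rw [← ENNReal.ofReal_natCast]
  refine ENNReal.ofReal_le_ofReal (le_of_not_ge fun hlt => ?_)
  exact absurd (SystoleGrowth.level_le_of_isAxis hτ (hJdet n) hγ hγ1 hc hlt) (not_le.mpr hn)
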